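/- Let $G$ be a compact connected Lie group with Lie algebra $\mathfrak g$, let $\cdot$ be an $\mathrm{Ad}$-invariant inner product on $\mathfrak g$, and let $g \ge 0$ be an integer. Let $F$ be the free group on $x_1, \dots, x_{2g}$, let $R = \prod_{i=1}^g [x_{2i-1}, x_{2i}] \in F$ with $[a,b] = aba^{-1}b^{-1}$, and let $c = \sum_{i=1}^{2g} (\partial R/\partial x_i, x_i)$ be the 2-chain on $F$ (an integral combination $\sum_{(a,b)} n_{(a,b)}\,(a,b)$ of elements of $F \times F$) given by the Fox derivatives $\partial R/\partial x_i \in \mathbb Z[F]$, which are determined by $\partial x_j/\partial x_i = \delta_{ij}$ and $\partial(uv)/\partial x_i = \partial u/\partial x_i + u\,\partial v/\partial x_i$. Let $\alpha$ and $\bar\alpha$ be the left- and right-invariant Maurer–Cartan forms on $G$, and let $\Omega = \alpha_1 \cdot \bar\alpha_2 \in \Omega^2(G \times G)$, where $\alpha_1 = \pi_1^*\alpha$, $\bar\alpha_2 = \pi_2^*\bar\alpha$, and the wedge product is combined with the inner product. On $Y = \mathrm{Hom}(F, G) = G^{2g}$ define $$\omega = \langle c, E^*\Omega\rangle = \sum_{(a,b)}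 n_{(a,b)}\, E_{(a,b)}^*\Omega, \qquad E_{(a,b)} : Y \to G \times G,\quad \rho \mapsto (\rho(a), \rho(b)).$$ Then $\omega$ is a smooth 2-form on $Y$ which is invariant under the action of $G$ on $Y$ by simultaneous conjugation: $\Phi_k^*\omega = \omega$ for every $k \in G$, where $\Phi_k(y_1, \dots, y_{2g}) = (k y_1 k^{-1}, \dots, k y_{2g} k^{-1})$; and for every $\eta \in \mathfrak g$, with $\tilde\eta$ the vector field on $Y$ generated by $\eta$, $$\mathcal L_{\tilde\eta}\,\omega = (d\,\iota_{\tilde\eta} + \iota_{\tilde\eta}\, d)\,\omega = 0 .$$ -/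

import Mathlib

open scoped Manifold ContDiff

noncomputable section

namespace SurfaceForm

/-! ### Fox calculus and the distinguished 2-chain on the free group -/

/-- The affine bijection `a ↦ x * a + b` of the group ring `ℤ[Γ]`, for `x ∈ Γ`. -/
def affinePerm {Γ : Type*} [Group Γ] (x : Γ) (b : MonoidAlgebra ℤ Γ) :
    Equiv.Perm (MonoidAlgebra ℤ Γ) where
  toFun a := MonoidAlgebra.of ℤ Γ x * a + b
  invFun a := MonoidAlgebra.of ℤ Γ x⁻¹ * (a - b)
  left_inv a := by
    beta_reduce
    rw [add_sub_cancel_right, ← mul_assoc, ← map_mul, inv_mul_cancel, map_one, one_mul]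
  right_inv a := by
    beta_reduce
    rw [← mul_assoc, ← map_mul, mul_inv_cancel, map_one, one_mul, sub_add_cancel]

/-- The action of the free group on its group ring by affine bijections in which the generator
`x_j` acts by `a ↦ x_j * a + δ_{ij}`. -/
def foxAction {ι : Type*} [DecidableEq ι] (i : ι) :
    FreeGroup ι →* Equiv.Perm (MonoidAlgebra ℤ (FreeGroup ι)) :=
  FreeGroup.lift fun j => affinePerm (FreeGroup.of j) (if i = j then 1 else 0)

/-- The Fox derivative `∂w/∂x_i ∈ ℤ[F]` of an element `w` of the free group `F`: the value at `0`
of the affine bijection by which `w` acts. It is the map determined by `∂x_j/∂x_i = δ_{ij}` and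
`∂(u v)/∂x_i = ∂u/∂x_i + u * ∂v/∂x_i`; see `foxDeriv_of` and `foxDeriv_mul`. -/
def foxDeriv {ι : Type*} [DecidableEq ι] (i : ι) (w : FreeGroup ι) :
    MonoidAlgebra ℤ (FreeGroup ι) :=
  foxAction i w 0

theorem foxAction_apply {ι : Type*} [DecidableEq ι] (i : ι) (w : FreeGroup ι) :
    ∀ a, foxAction i w a = MonoidAlgebra.of ℤ (FreeGroup ι) w * a + foxDeriv i w := by
  unfold foxDeriv
  induction w using FreeGroup.induction_on with
  | C1 => intro a; rw [map_one, map_one]; simp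
  | of j => intro a; simp [foxAction, affinePerm]
  | inv_of j _ =>
    intro a
    have h : ∀ b, foxAction i (FreeGroup.of j)⁻¹ b =
        MonoidAlgebra.of ℤ (FreeGroup ι) (FreeGroup.of j)⁻¹ * (b - if i = j then 1 else 0) := by
      intro b
      rw [map_inv, Equiv.Perm.inv_def]
      simp only [foxAction, FreeGroup.lift_apply_of]
      rfl
    rw [h, h, zero_sub, mul_sub, mul_neg, sub_eq_add_neg]
  | mul x y hx hy =>
    intro a
    rw [map_mul, Equiv.Perm.mul_apply, Equiv.Perm.mul_apply, hx, hx (foxAction i y 0), hy a,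
      map_mul, mul_add, mul_assoc, add_assoc]

theorem foxDeriv_of {ι : Type*} [DecidableEq ι] (i j : ι) :
    foxDeriv i (FreeGroup.of j) = if i = j then 1 else 0 := by
  simp [foxDeriv, foxAction, affinePerm]

theorem foxDeriv_mul {ι : Type*} [DecidableEq ι] (i : ι) (u v : FreeGroup ι) :
    foxDeriv i (u * v) = foxDeriv i u + MonoidAlgebra.of ℤ (FreeGroup ι) u * foxDeriv i v := by
  rw [add_comm, ← foxAction_apply]
  simp [foxDeriv, Equiv.Perm.mul_apply]

/-- The surface relation `R = [x₀, x₁] [x₂, x₃] ⋯ [x_{2g-2}, x_{2g-1}]` (product in this order) in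
the free group on `2g` generators, where `[a, b] = a b a⁻¹ b⁻¹`. -/
def surfaceRelation (g : ℕ) : FreeGroup (Fin (2 * g)) :=
  (List.ofFn fun i : Fin g =>
    FreeGroup.of (⟨2 * i, by omega⟩ : Fin (2 * g)) *
      FreeGroup.of (⟨2 * i + 1, by omega⟩ : Fin (2 * g)) *
      (FreeGroup.of (⟨2 * i, by omega⟩ : Fin (2 * g)))⁻¹ *
      (FreeGroup.of (⟨2 * i + 1, by omega⟩ : Fin (2 * g)))⁻¹).prod

/-- The Eilenberg–Mac Lane 2-chain `c = ∑ᵢ (∂R/∂xᵢ, xᵢ) ∈ C₂(F)`; 2-chains are the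
`ℤ`-linear combinations of elements of `F × F`, and `(·, ·)` is extended additively in the first
entry. -/
def surfaceChain (g : ℕ) : FreeGroup (Fin (2 * g)) × FreeGroup (Fin (2 * g)) →₀ ℤ :=
  ∑ i : Fin (2 * g),
    (foxDeriv i (surfaceRelation g)).coeff.mapDomain fun u => (u, FreeGroup.of i)

/-! ### Differential forms on manifolds -/

section Forms

variable {E : Type*} [NormedAddCommGroup E] [NormedSpace ℝ E]
  {H : Type*} [TopologicalSpace H] (I : ModelWithCorners ℝ E H)
  (M : Type*) [TopologicalSpace M] [ChartedSpace H M]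

/-- Real-valued differential `k`-forms on `M` (no regularity imposed). -/
abbrev DForm (k : ℕ) : Type _ := ∀ x : M, TangentSpace I x [⋀^Fin k]→L[ℝ] ℝ

variable {I M}
variable {E' : Type*} [NormedAddCommGroup E'] [NormedSpace ℝ E']
  {H' : Type*} [TopologicalSpace H'] {I' : ModelWithCorners ℝ E' H'}
  {N : Type*} [TopologicalSpace N] [ChartedSpace H' N]

/-- The pullback `f^* β` of a form. -/
def DForm.pullback {k : ℕ} (f : M → N) (β : DForm I' N k) : DForm I M k := fun x =>
  (β (f x)).compContinuousLinearMap (mfderiv I I' f x)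

/-- The expression of a form in the extended chart around `x₀`, that is its pullback under the
inverse of that chart. -/
def DForm.inChart {k : ℕ} (β : DForm I M k) (x₀ : M) (z : E) : E [⋀^Fin k]→L[ℝ] ℝ :=
  (β ((extChartAt I x₀).symm z)).compContinuousLinearMap
    (mfderivWithin 𝓘(ℝ, E) I (extChartAt I x₀).symm (Set.range I) z)

/-- A form is smooth if all its chart expressions are. -/
def DForm.IsSmooth {k : ℕ} (β : DForm I M k) : Prop :=
  ∀ x₀ : M, ContDiffOn ℝ ∞ (β.inChart x₀) (extChartAt I x₀).target

/-- The exterior derivative `d β` of a form, computed at `x` in the chart around `x`. -/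
def DForm.d {k : ℕ} (β : DForm I M k) : DForm I M (k + 1) := fun x =>
  (extDerivWithin (β.inChart x) (Set.range I) (extChartAt I x x)).compContinuousLinearMap
    (mfderiv I 𝓘(ℝ, E) (extChartAt I x) x)

/-- The interior product `ι_X β = β(X, ·, …, ·)`. -/
def DForm.interior {k : ℕ} (X : ∀ x : M, TangentSpace I x) (β : DForm I M (k + 1)) :
    DForm I M k := fun x =>
  ContinuousAlternatingMap.curryLeft (E := E) (β x) (X x)

/-- The Lie derivative `L_X β = d (ι_X β) + ι_X (d β)` of a form of positive degree. -/
def DForm.lieDeriv {k : ℕ} (X : ∀ x : M, TangentSpace I x) (β : DForm I M (k + 1)) :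
    DForm I M (k + 1) :=
  (β.interior X).d + β.d.interior X

end Forms

/-- For linear maps `a b : V → W` and a bilinear form `B` on `W`, the alternating 2-form
`a · b : (v, w) ↦ B (a v) (b w) - B (a w) (b v)` (wedge product combined with `B`). -/
def wedgeBilin {V W : Type*} [AddCommGroup V] [Module ℝ V] [TopologicalSpace V]
    [AddCommGroup W] [Module ℝ W] [TopologicalSpace W] [IsTopologicalAddGroup W]
    [ContinuousSMul ℝ W] [FiniteDimensional ℝ W] [T2Space W]
    (B : LinearMap.BilinForm ℝ W) (a b : V →L[ℝ] W) : V [⋀^Fin 2]→L[ℝ] ℝ where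
  toFun v := B (a (v 0)) (b (v 1)) - B (a (v 1)) (b (v 0))
  map_update_add' := by
    intro _ m i x y
    obtain rfl : ‹DecidableEq (Fin 2)› = instDecidableEqFin 2 := Subsingleton.elim _ _
    fin_cases i <;> simp <;> ring
  map_update_smul' := by
    intro _ m i c x
    obtain rfl : ‹DecidableEq (Fin 2)› = instDecidableEqFin 2 := Subsingleton.elim _ _
    fin_cases i <;> simp <;> ring
  map_eq_zero_of_eq' := by
    intro v i j h hij
    fin_cases i <;> fin_cases j <;> simp_all
  cont := by
    have hB : ∀ f g : (Fin 2 → V) → W, Continuous f → Continuous g →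
        Continuous fun v => B (f v) (g v) := by
      intro f g hf hg
      let e := Module.finBasis ℝ W
      have h : ∀ x y : W, B x y = ∑ i, e.coord i x * B (e i) y := by
        intro x y
        conv_lhs => rw [← e.sum_repr x]
        simp only [map_sum, map_smul, LinearMap.sum_apply, LinearMap.smul_apply, smul_eq_mul]
        rfl
      rw [funext fun v => h (f v) (g v)]
      exact continuous_finsetSum _ fun i _ =>
        ((LinearMap.continuous_of_finiteDimensional (e.coord i)).comp hf).mul
          ((LinearMap.continuous_of_finiteDimensional (B (e i))).comp hg)
    exact (hB _ _ (a.continuous.comp (continuous_apply 0))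
      (b.continuous.comp (continuous_apply 1))).sub
      (hB _ _ (a.continuous.comp (continuous_apply 1)) (b.continuous.comp (continuous_apply 0)))

/-! ### The 2-form on `G^{2g}` -/

section LieGroup

variable {E : Type*} [NormedAddCommGroup E] [NormedSpace ℝ E]
  {H : Type*} [TopologicalSpace H] (I : ModelWithCorners ℝ E H)
  (G : Type*) [TopologicalSpace G] [ChartedSpace H G] [Group G]

variable {G} in
/-- The adjoint action of `k ∈ G` on the Lie algebra: the derivative at `1` of conjugation. -/
def Ad (k : G) : GroupLieAlgebra I G →L[ℝ] GroupLieAlgebra I G :=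
  mfderiv I I (fun x : G => k * x * k⁻¹) 1

/-- An `Ad`-invariant inner product on the Lie algebra of `G`. -/
structure InvariantInnerProduct where
  /-- the underlying bilinear form -/
  form : LinearMap.BilinForm ℝ (GroupLieAlgebra I G)
  symm : ∀ ξ η, form ξ η = form η ξ
  pos : ∀ ξ, ξ ≠ 0 → 0 < form ξ ξ
  invariant : ∀ (k : G) (ξ η), form (Ad I k ξ) (Ad I k η) = form ξ η

variable {G}

/-- The left-invariant Maurer–Cartan form: `v ∈ T_x G ↦ (L_{x⁻¹})_* v`. -/
def leftMaurerCartan (x : G) : TangentSpace I x →L[ℝ] GroupLieAlgebra I G :=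
  mfderiv I I (fun y : G => x⁻¹ * y) x

/-- The right-invariant Maurer–Cartan form: `v ∈ T_x G ↦ (R_{x⁻¹})_* v`. -/
def rightMaurerCartan (x : G) : TangentSpace I x →L[ℝ] GroupLieAlgebra I G :=
  mfderiv I I (fun y : G => y * x⁻¹) x

variable {I}

/-- The 2-form `Ω = α₁ · ᾱ₂` on `G × G`, where `α₁` is the pullback of the left-invariant
Maurer–Cartan form under the first projection, and `ᾱ₂` that of the right-invariant one under the
second projection. -/
def weinsteinForm [FiniteDimensional ℝ E] (B : InvariantInnerProduct I G) :
    DForm (I.prod I) (G × G) 2 := fun p =>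
  haveI : FiniteDimensional ℝ (GroupLieAlgebra I G) := inferInstanceAs (FiniteDimensional ℝ E)
  haveI : T2Space (GroupLieAlgebra I G) := inferInstanceAs (T2Space E)
  wedgeBilin B.form
    ((leftMaurerCartan I p.1).comp (mfderiv (I.prod I) I Prod.fst p))
    ((rightMaurerCartan I p.2).comp (mfderiv (I.prod I) I Prod.snd p))

/-- The evaluation map `Hom(F, G) = G^m → G × G` at a pair of elements of the free group `F` on `m`
generators. -/
def evalPair {m : ℕ} (p : FreeGroup (Fin m) × FreeGroup (Fin m)) (y : Fin m → G) : G × G :=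
  (FreeGroup.lift y p.1, FreeGroup.lift y p.2)

/-- The pairing `⟨c, E^* β⟩` of a 2-chain `c` on the free group with a form `β` on `G × G`: if
`c = ∑ nₚ p`, this is the form `∑ nₚ Eₚ^* β` on `G^m`. -/
def chainPairing {m k : ℕ} (c : FreeGroup (Fin m) × FreeGroup (Fin m) →₀ ℤ)
    (β : DForm (I.prod I) (G × G) k) :
    DForm (ModelWithCorners.pi fun _ : Fin m => I) (Fin m → G) k := fun y =>
  c.sum fun p n => (n : ℝ) • DForm.pullback (evalPair p) β y

/-- The 2-form `ω = ⟨c, E^* Ω⟩` on `G^{2g}`. -/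
def surfaceForm [FiniteDimensional ℝ E] (B : InvariantInnerProduct I G) (g : ℕ) :
    DForm (ModelWithCorners.pi fun _ : Fin (2 * g) => I) (Fin (2 * g) → G) 2 :=
  chainPairing (surfaceChain g) (weinsteinForm B)

/-- The action of `G` on `G^m` by simultaneous conjugation. -/
def conjAct {m : ℕ} (k : G) (y : Fin m → G) : Fin m → G := fun i => k * y i * k⁻¹

/-- The vector field on `G^m` generated by `η ∈ 𝔤` under the conjugation action: its value at `y` is
the image of `η` under the derivative at `1` of the orbit map `k ↦ k y k⁻¹`. -/
def generatedField {m : ℕ} (η : GroupLieAlgebra I G) (y : Fin m → G) :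
    TangentSpace (ModelWithCorners.pi fun _ : Fin m => I) y :=
  mfderiv I (ModelWithCorners.pi fun _ : Fin m => I) (fun k : G => conjAct k y) 1 η

end LieGroup

end SurfaceForm

end

noncomputable section

namespace SurfaceForm

section PiManifold

variable {ι : Type*} [Fintype ι]
  {E : Type*} [NormedAddCommGroup E] [NormedSpace ℝ E]
  {H : Type*} [TopologicalSpace H] {I : ModelWithCorners ℝ E H}
  {M : Type*} [TopologicalSpace M] [ChartedSpace H M]
  {E' : Type*} [NormedAddCommGroup E'] [NormedSpace ℝ E']
  {H' : Type*} [TopologicalSpace H'] {I' : ModelWithCorners ℝ E' H'}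
  {N : Type*} [TopologicalSpace N] [ChartedSpace H' N] {n : WithTop ℕ∞}

instance boundaryless_pi [I.Boundaryless] :
    (ModelWithCorners.pi fun _ : ι => I).Boundaryless where
  range_eq_univ := by
    refine Set.eq_univ_of_forall fun z => ?_
    have h : ∀ i, ∃ x : H, I x = z i := fun i => by
      have : z i ∈ Set.range I := by rw [I.range_eq_univ]; trivial
      exact this
    choose x hx using h
    exact ⟨x, funext hx⟩

theorem contMDiffAt_pi_iff {f : N → ι → M} {x : N} :
    ContMDiffAt I' (ModelWithCorners.pi fun _ : ι => I) n f x ↔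
      ∀ i, ContMDiffAt I' I n (fun y => f y i) x := by
  simp only [contMDiffAt_iff, continuousAt_pi, forall_and]
  exact and_congr Iff.rfl contDiffWithinAt_pi

theorem contMDiff_pi_iff {f : N → ι → M} :
    ContMDiff I' (ModelWithCorners.pi fun _ : ι => I) n f ↔
      ∀ i, ContMDiff I' I n (fun y => f y i) :=
  ⟨fun h i x => contMDiffAt_pi_iff.1 (h x) i, fun h x => contMDiffAt_pi_iff.2 fun i => h i x⟩

theorem contMDiff_eval (i : ι) :
    ContMDiff (ModelWithCorners.pi fun _ : ι => I) I n (fun y : ι → M => y i) :=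
  contMDiff_pi_iff.1 contMDiff_id i

instance isManifold_pi [IsManifold I n M] :
    IsManifold (ModelWithCorners.pi fun _ : ι => I) n (ι → M) := by
  apply isManifold_of_contDiffOn
  rintro _ _ ⟨e, he, rfl⟩ ⟨e', he', rfl⟩
  refine contDiffOn_pi.2 fun i => ?_
  have h : ContDiffOn ℝ n (I ∘ (e i).symm ≫ₕ e' i ∘ I.symm)
      (I.symm ⁻¹' ((e i).symm ≫ₕ e' i).source ∩ Set.range I) :=
    mem_groupoid_of_pregroupoid.1
      (StructureGroupoid.compatible (contDiffGroupoid n I) (he i trivial) (he' i trivial)) |>.1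
  refine h.comp (contDiff_apply ℝ E i).contDiffOn ?_
  rintro z ⟨⟨h₁, h₂⟩, w, rfl⟩
  exact ⟨⟨h₁ i trivial, h₂ i trivial⟩, w i, rfl⟩

end PiManifold

section Pullback

variable {E : Type*} [NormedAddCommGroup E] [NormedSpace ℝ E]
  {H : Type*} [TopologicalSpace H] {I : ModelWithCorners ℝ E H}
  {M : Type*} [TopologicalSpace M] [ChartedSpace H M]
  {E' : Type*} [NormedAddCommGroup E'] [NormedSpace ℝ E']
  {H' : Type*} [TopologicalSpace H'] {I' : ModelWithCorners ℝ E' H'}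
  {N : Type*} [TopologicalSpace N] [ChartedSpace H' N]
  {E'' : Type*} [NormedAddCommGroup E''] [NormedSpace ℝ E'']
  {H'' : Type*} [TopologicalSpace H''] {I'' : ModelWithCorners ℝ E'' H''}
  {P : Type*} [TopologicalSpace P] [ChartedSpace H'' P] {k : ℕ}

theorem DForm.pullback_pullback (β : DForm I'' P k) {f : M → N} {g : N → P} {x : M}
    (hg : MDifferentiableAt I' I'' g (f x)) (hf : MDifferentiableAt I I' f x) :
    (β.pullback (I := I') g).pullback (I := I) f x = β.pullback (g ∘ f) x := by
  ext v
  change β (g (f x)) _ = β (g (f x)) _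
  congr 1
  funext i
  exact (mfderiv_comp_apply x hg hf (v i)).symm

theorem DForm.pullback_congr (β : DForm I' N k) {f g : M → N} {x : M}
    (h : f =ᶠ[nhds x] g) : β.pullback (I := I) f x = β.pullback g x := by
  have h₁ : ∀ p q : N, p = q → (β p : E' [⋀^Fin k]→L[ℝ] ℝ) = β q := by
    rintro p _ rfl; rfl
  have h₂ : (mfderiv I I' f x : E →L[ℝ] E') = mfderiv I I' g x := h.mfderiv_eq
  exact congrArg₂ (fun (a : E' [⋀^Fin k]→L[ℝ] ℝ) (b : E →L[ℝ] E') =>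
    a.compContinuousLinearMap b) (h₁ _ _ h.eq_of_nhds) h₂

theorem DForm.pullback_finsetSum_smul {σ : Type*} (s : Finset σ) (c : σ → ℝ)
    (β : σ → DForm I' N k) (f : M → N) (x : M) :
    DForm.pullback (I := I) f (fun y => ∑ p ∈ s, c p • β p y) x =
      ∑ p ∈ s, c p • (β p).pullback f x := by
  ext v
  simp only [DForm.pullback, ContinuousAlternatingMap.compContinuousLinearMap_apply,
    ContinuousAlternatingMap.sum_apply, ContinuousAlternatingMap.smul_apply]

theorem DForm.inChart_eq_pullback [I.Boundaryless] (β : DForm I M k) (x : M) (z : E) :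
    β.inChart x z = β.pullback (I := 𝓘(ℝ, E)) (extChartAt I x).symm z := by
  unfold DForm.inChart DForm.pullback
  rw [I.range_eq_univ, mfderivWithin_univ]
  rfl

theorem mdifferentiableAt_extChartAt_symm [I.Boundaryless] [IsManifold I ∞ M] {x : M} {z : E}
    (hz : z ∈ (extChartAt I x).target) :
    MDifferentiableAt 𝓘(ℝ, E) I (extChartAt I x).symm z :=
  ((contMDiffOn_extChartAt_symm (n := ∞) x).contMDiffAt
    ((isOpen_extChartAt_target x).mem_nhds hz)).mdifferentiableAt (by simp)

end Pullback

section MaurerCartan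

variable {E : Type*} [NormedAddCommGroup E] [NormedSpace ℝ E]
  {H : Type*} [TopologicalSpace H] {I : ModelWithCorners ℝ E H}
  {G : Type*} [TopologicalSpace G] [ChartedSpace H G] [Group G]
  {E' : Type*} [NormedAddCommGroup E'] [NormedSpace ℝ E']
  {H' : Type*} [TopologicalSpace H'] {J : ModelWithCorners ℝ E' H'}
  {M : Type*} [TopologicalSpace M] [ChartedSpace H' M]
  {E'' : Type*} [NormedAddCommGroup E''] [NormedSpace ℝ E'']
  {H'' : Type*} [TopologicalSpace H''] {J' : ModelWithCorners ℝ E'' H''}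
  {N : Type*} [TopologicalSpace N] [ChartedSpace H'' N]

variable (I J) in
/-- The pullback `a^* α` of the left-invariant Maurer–Cartan form under `a : M → G`. -/
def leftLogDeriv (a : M → G) (x : M) : TangentSpace J x →L[ℝ] GroupLieAlgebra I G :=
  mfderiv J I (fun y => (a x)⁻¹ * a y) x

variable (I J) in
/-- The pullback `b^* ᾱ` of the right-invariant Maurer–Cartan form under `b : M → G`. -/
def rightLogDeriv (b : M → G) (x : M) : TangentSpace J x →L[ℝ] GroupLieAlgebra I G :=
  mfderiv J I (fun y => b y * (b x)⁻¹) x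

theorem mdifferentiable_mul_left_const [LieGroup I ∞ G] (k : G) :
    MDifferentiable I I (fun x : G => k * x) :=
  (contMDiff_mul_left (I := I) (n := ∞) (a := k)).mdifferentiable (by simp)

theorem mdifferentiable_mul_right_const [LieGroup I ∞ G] (k : G) :
    MDifferentiable I I (fun x : G => x * k) :=
  (contMDiff_mul_right (I := I) (n := ∞) (a := k)).mdifferentiable (by simp)

theorem mdifferentiable_conj [LieGroup I ∞ G] (k : G) :
    MDifferentiable I I (fun x : G => k * x * k⁻¹) :=
  (mdifferentiable_mul_right_const k⁻¹).comp (mdifferentiable_mul_left_const k)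

theorem leftLogDeriv_comp [LieGroup I ∞ G] {a : M → G} {f : N → M} {x : N}
    (ha : MDifferentiableAt J I a (f x)) (hf : MDifferentiableAt J' J f x) :
    leftLogDeriv I J' (a ∘ f) x = (leftLogDeriv I J a (f x)).comp (mfderiv J' J f x) :=
  mfderiv_comp x (g := fun y => (a (f x))⁻¹ * a y)
    (((mdifferentiable_mul_left_const _) _).comp _ ha) hf

theorem rightLogDeriv_comp [LieGroup I ∞ G] {a : M → G} {f : N → M} {x : N}
    (ha : MDifferentiableAt J I a (f x)) (hf : MDifferentiableAt J' J f x) :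
    rightLogDeriv I J' (a ∘ f) x = (rightLogDeriv I J a (f x)).comp (mfderiv J' J f x) :=
  mfderiv_comp x (g := fun y => a y * (a (f x))⁻¹)
    (((mdifferentiable_mul_right_const _) _).comp _ ha) hf

theorem leftLogDeriv_conj [LieGroup I ∞ G] {a : M → G} {x : M} (k : G)
    (ha : MDifferentiableAt J I a x) :
    leftLogDeriv I J (fun y => k * a y * k⁻¹) x = (Ad I k).comp (leftLogDeriv I J a x) := by
  have h : (fun y => (k * a x * k⁻¹)⁻¹ * (k * a y * k⁻¹)) =
      (fun u : G => k * u * k⁻¹) ∘ fun y => (a x)⁻¹ * a y := by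
    funext y; simp only [Function.comp]; group
  have h₁ := mfderiv_comp x (g := fun u : G => k * u * k⁻¹) (f := fun y => (a x)⁻¹ * a y)
    ((mdifferentiable_conj (I := I) k) _) (((mdifferentiable_mul_left_const _) _).comp x ha)
  have h₂ : ∀ u : G, u = 1 → (mfderiv I I (fun u : G => k * u * k⁻¹) u : E →L[ℝ] E) = Ad I k := by
    rintro _ rfl; rfl
  have h₃ : (leftLogDeriv I J (fun y => k * a y * k⁻¹) x : E' →L[ℝ] E) =
      mfderiv J I ((fun u : G => k * u * k⁻¹) ∘ fun y => (a x)⁻¹ * a y) x := by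
    rw [← h]; rfl
  exact h₃.trans (h₁.trans
    (congrArg (fun T : E →L[ℝ] E => T.comp (leftLogDeriv I J a x : E' →L[ℝ] E))
      (h₂ _ (inv_mul_cancel _))))

theorem rightLogDeriv_conj [LieGroup I ∞ G] {a : M → G} {x : M} (k : G)
    (ha : MDifferentiableAt J I a x) :
    rightLogDeriv I J (fun y => k * a y * k⁻¹) x = (Ad I k).comp (rightLogDeriv I J a x) := by
  have h : (fun y => (k * a y * k⁻¹) * (k * a x * k⁻¹)⁻¹) =
      (fun u : G => k * u * k⁻¹) ∘ fun y => a y * (a x)⁻¹ := by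
    funext y; simp only [Function.comp]; group
  have h₁ := mfderiv_comp x (g := fun u : G => k * u * k⁻¹) (f := fun y => a y * (a x)⁻¹)
    ((mdifferentiable_conj (I := I) k) _) (((mdifferentiable_mul_right_const _) _).comp x ha)
  have h₂ : ∀ u : G, u = 1 → (mfderiv I I (fun u : G => k * u * k⁻¹) u : E →L[ℝ] E) = Ad I k := by
    rintro _ rfl; rfl
  have h₃ : (rightLogDeriv I J (fun y => k * a y * k⁻¹) x : E' →L[ℝ] E) =
      mfderiv J I ((fun u : G => k * u * k⁻¹) ∘ fun y => a y * (a x)⁻¹) x := by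
    rw [← h]; rfl
  exact h₃.trans (h₁.trans
    (congrArg (fun T : E →L[ℝ] E => T.comp (rightLogDeriv I J a x : E' →L[ℝ] E))
      (h₂ _ (mul_inv_cancel _))))

theorem inTangentCoordinates_id_const {G : Type*} [TopologicalSpace G] [ChartedSpace H G]
    [IsManifold I 1 G] (c : G) (z₀ : E')
    (ϕ : E' → E' →L[ℝ] E) :
    inTangentCoordinates 𝓘(ℝ, E') I id (fun _ => c) ϕ z₀ = ϕ := by
  funext z
  rw [inTangentCoordinates_eq _ _ _ (by rw [chartAt_self_eq]; trivial) (mem_chart_source H c)]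
  ext v
  simp only [ContinuousLinearMap.comp_apply]
  rw [(tangentBundleCore I G).coordChange_self (achart H c) c (mem_chart_source H c)]
  congr 1
  exact (tangentBundleCore 𝓘(ℝ, E') E').coordChange_self (achart E' z₀) z trivial v

/-- Derivatives of a family of maps `f z` at `z` which send `z` to a fixed point depend smoothly
on `z`. -/
theorem contDiffAt_mfderiv_of_apply_eq {G : Type*} [TopologicalSpace G] [ChartedSpace H G]
    [IsManifold I ∞ G] {f : E' → E' → G} {z₀ : E'} {c : G}
    (hf : ContMDiffAt (𝓘(ℝ, E').prod 𝓘(ℝ, E')) I ∞ (Function.uncurry f) (z₀, z₀))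
    (hc : ∀ z, f z z = c) :
    ContDiffAt (E := E') (F := E' →L[ℝ] E) ℝ ∞
      (fun z => mfderiv 𝓘(ℝ, E') I (f z) z) z₀ := by
  have h := ContMDiffAt.mfderiv f id (n := ∞) (m := ∞) (x₀ := z₀) hf contMDiffAt_id (by simp)
  have e := inTangentCoordinates_id_const (I := I) c z₀
    (fun z => mfderiv 𝓘(ℝ, E') I (f z) z)
  have hc' : (fun z => f z (id z)) = fun _ => c := funext hc
  rw [hc'] at h
  exact (e ▸ h : ContMDiffAt 𝓘(ℝ, E') 𝓘(ℝ, E' →L[ℝ] E) ∞ _ z₀).contDiffAt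

theorem contDiffAt_leftLogDeriv [LieGroup I ∞ G] {a : E' → G} {z₀ : E'}
    (ha : ContMDiffAt 𝓘(ℝ, E') I ∞ a z₀) :
    ContDiffAt (E := E') (F := E' →L[ℝ] E) ℝ ∞
      (fun z => leftLogDeriv I 𝓘(ℝ, E') a z) z₀ := by
  refine contDiffAt_mfderiv_of_apply_eq (f := fun z y => (a z)⁻¹ * a y) (c := 1) ?_
    fun z => inv_mul_cancel _
  exact ((ContMDiffAt.comp (z₀, z₀) (g := a) ha contMDiffAt_fst).inv).mul
    (ContMDiffAt.comp (z₀, z₀) (g := a) ha contMDiffAt_snd)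

theorem contDiffAt_rightLogDeriv [LieGroup I ∞ G] {a : E' → G} {z₀ : E'}
    (ha : ContMDiffAt 𝓘(ℝ, E') I ∞ a z₀) :
    ContDiffAt (E := E') (F := E' →L[ℝ] E) ℝ ∞
      (fun z => rightLogDeriv I 𝓘(ℝ, E') a z) z₀ := by
  refine contDiffAt_mfderiv_of_apply_eq (f := fun z y => a y * (a z)⁻¹) (c := 1) ?_
    fun z => mul_inv_cancel _
  exact (ContMDiffAt.comp (z₀, z₀) (g := a) ha contMDiffAt_snd).mul
    ((ContMDiffAt.comp (z₀, z₀) (g := a) ha contMDiffAt_fst).inv)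

theorem wedgeBilin_apply {V W : Type*} [AddCommGroup V] [Module ℝ V] [TopologicalSpace V]
    [AddCommGroup W] [Module ℝ W] [TopologicalSpace W] [IsTopologicalAddGroup W]
    [ContinuousSMul ℝ W] [FiniteDimensional ℝ W] [T2Space W]
    (B : LinearMap.BilinForm ℝ W) (a b : V →L[ℝ] W) (v : Fin 2 → V) :
    wedgeBilin B a b v = B (a (v 0)) (b (v 1)) - B (a (v 1)) (b (v 0)) :=
  rfl

theorem contDiffAt_wedgeBilin {V W : Type*} [NormedAddCommGroup V] [NormedSpace ℝ V]
    [FiniteDimensional ℝ V] [NormedAddCommGroup W] [NormedSpace ℝ W] [FiniteDimensional ℝ W]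
    (B : LinearMap.BilinForm ℝ W) {a b : V → V →L[ℝ] W} {z₀ : V} (ha : ContDiffAt ℝ ∞ a z₀)
    (hb : ContDiffAt ℝ ∞ b z₀) : ContDiffAt ℝ ∞ (fun z => wedgeBilin B (a z) (b z)) z₀ := by
  let T : (V →L[ℝ] W) →ₗ[ℝ] (V →L[ℝ] W) →ₗ[ℝ] V [⋀^Fin 2]→L[ℝ] ℝ :=
    LinearMap.mk₂ ℝ (wedgeBilin B)
      (fun a a' b => by ext v; simp [wedgeBilin_apply]; ring)
      (fun c a b => by ext v; simp [wedgeBilin_apply]; ring)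
      (fun a b b' => by ext v; simp [wedgeBilin_apply]; ring)
      (fun c a b => by ext v; simp [wedgeBilin_apply]; ring)
  exact ((T.toContinuousBilinearMap.contDiff.contDiffAt).comp z₀ ha).clm_apply hb

variable [FiniteDimensional ℝ E]

variable (J) in
/-- The 2-form `a^* α · b^* ᾱ` on `M` for maps `a b : M → G`. -/
def logDerivForm (B : InvariantInnerProduct I G) (a b : M → G) : DForm J M 2 := fun x =>
  haveI : FiniteDimensional ℝ (GroupLieAlgebra I G) := inferInstanceAs (FiniteDimensional ℝ E)
  haveI : T2Space (GroupLieAlgebra I G) := inferInstanceAs (T2Space E)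
  wedgeBilin B.form (leftLogDeriv I J a x) (rightLogDeriv I J b x)

theorem logDerivForm_apply (B : InvariantInnerProduct I G) (a b : M → G) (x : M)
    (v : Fin 2 → TangentSpace J x) : logDerivForm J B a b x v =
      B.form (leftLogDeriv I J a x (v 0)) (rightLogDeriv I J b x (v 1)) -
        B.form (leftLogDeriv I J a x (v 1)) (rightLogDeriv I J b x (v 0)) :=
  rfl

theorem pullback_logDerivForm [LieGroup I ∞ G] (B : InvariantInnerProduct I G) {a b : M → G}
    {f : N → M} {x : N} (ha : MDifferentiableAt J I a (f x)) (hb : MDifferentiableAt J I b (f x))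
    (hf : MDifferentiableAt J' J f x) :
    (logDerivForm J B a b).pullback (I := J') f x = logDerivForm J' B (a ∘ f) (b ∘ f) x := by
  ext v
  rw [logDerivForm_apply, leftLogDeriv_comp ha hf, rightLogDeriv_comp hb hf]
  rfl

theorem weinsteinForm_eq_logDerivForm [LieGroup I ∞ G] (B : InvariantInnerProduct I G) :
    weinsteinForm B = logDerivForm (I.prod I) B Prod.fst Prod.snd := by
  funext p
  ext v
  rw [logDerivForm_apply]
  have h₁ : leftLogDeriv I (I.prod I) Prod.fst p =
      (leftMaurerCartan I p.1).comp (mfderiv (I.prod I) I Prod.fst p) :=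
    leftLogDeriv_comp (a := id) (f := Prod.fst) mdifferentiableAt_id mdifferentiableAt_fst
  have h₂ : rightLogDeriv I (I.prod I) Prod.snd p =
      (rightMaurerCartan I p.2).comp (mfderiv (I.prod I) I Prod.snd p) :=
    rightLogDeriv_comp (a := id) (f := Prod.snd) mdifferentiableAt_id mdifferentiableAt_snd
  rw [h₁, h₂]
  rfl

theorem logDerivForm_conj [LieGroup I ∞ G] (B : InvariantInnerProduct I G) {a b : M → G} {x : M}
    (k : G) (ha : MDifferentiableAt J I a x) (hb : MDifferentiableAt J I b x) :
    logDerivForm J B (fun y => k * a y * k⁻¹) (fun y => k * b y * k⁻¹) x =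
      logDerivForm J B a b x := by
  ext v
  rw [logDerivForm_apply, logDerivForm_apply, leftLogDeriv_conj k ha, rightLogDeriv_conj k hb]
  exact congrArg₂ (· - ·) (B.invariant k _ _) (B.invariant k _ _)

theorem contDiffAt_logDerivForm [LieGroup I ∞ G] [FiniteDimensional ℝ E']
    (B : InvariantInnerProduct I G) {a b : E' → G} {z₀ : E'}
    (ha : ContMDiffAt 𝓘(ℝ, E') I ∞ a z₀) (hb : ContMDiffAt 𝓘(ℝ, E') I ∞ b z₀) :
    ContDiffAt (E := E') (F := E' [⋀^Fin 2]→L[ℝ] ℝ) ℝ ∞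
      (fun z => logDerivForm 𝓘(ℝ, E') B a b z) z₀ :=
  contDiffAt_wedgeBilin (V := E') (W := E) B.form (contDiffAt_leftLogDeriv ha)
    (contDiffAt_rightLogDeriv hb)

end MaurerCartan

section SurfaceForm

theorem freeGroup_lift_conjAct {G : Type*} [Group G] {m : ℕ} (k : G) (y : Fin m → G) (w : FreeGroup (Fin m)) :
    FreeGroup.lift (conjAct k y) w = k * FreeGroup.lift y w * k⁻¹ := by
  have h : FreeGroup.lift (conjAct k y) = (MulAut.conj k).toMonoidHom.comp (FreeGroup.lift y) := by
    ext i; simp [conjAct]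
  rw [h]; simp

variable {E : Type*} [NormedAddCommGroup E] [NormedSpace ℝ E]
  {H : Type*} [TopologicalSpace H] {I : ModelWithCorners ℝ E H}
  {G : Type*} [TopologicalSpace G] [ChartedSpace H G] [Group G] [LieGroup I ∞ G]

theorem contMDiff_freeGroup_lift {m : ℕ} (w : FreeGroup (Fin m)) :
    ContMDiff (ModelWithCorners.pi fun _ : Fin m => I) I ∞
      (fun y : Fin m → G => FreeGroup.lift y w) := by
  induction w using FreeGroup.induction_on with
  | C1 => simpa using contMDiff_const
  | of j => simpa using contMDiff_eval j
  | inv_of j h => simpa using h.inv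
  | mul x y hx hy => simpa [Pi.mul_def] using hx.mul hy

theorem mdifferentiable_freeGroup_lift {m : ℕ} (w : FreeGroup (Fin m)) :
    MDifferentiable (ModelWithCorners.pi fun _ : Fin m => I) I
      (fun y : Fin m → G => FreeGroup.lift y w) :=
  (contMDiff_freeGroup_lift w).mdifferentiable (by simp)

theorem contMDiff_conjAct {m : ℕ} :
    ContMDiff (I.prod (ModelWithCorners.pi fun _ : Fin m => I))
      (ModelWithCorners.pi fun _ : Fin m => I) ∞
      (fun p : G × (Fin m → G) => conjAct p.1 p.2) :=
  contMDiff_pi_iff.2 fun i =>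
    (contMDiff_fst.mul ((contMDiff_eval i).comp contMDiff_snd)).mul contMDiff_fst.inv

theorem mdifferentiable_conjAct {m : ℕ} (k : G) :
    MDifferentiable (ModelWithCorners.pi fun _ : Fin m => I)
      (ModelWithCorners.pi fun _ : Fin m => I) (conjAct k : (Fin m → G) → Fin m → G) :=
  (contMDiff_conjAct.comp (contMDiff_const (c := k) |>.prodMk contMDiff_id)).mdifferentiable
    (by simp)

variable [FiniteDimensional ℝ E]

theorem chainPairing_weinsteinForm {m : ℕ} (B : InvariantInnerProduct I G)
    (c : FreeGroup (Fin m) × FreeGroup (Fin m) →₀ ℤ) (y : Fin m → G) :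
    chainPairing c (weinsteinForm B) y = c.sum fun p n => (n : ℝ) •
      logDerivForm (ModelWithCorners.pi fun _ : Fin m => I) B
        (fun y => FreeGroup.lift y p.1) (fun y => FreeGroup.lift y p.2) y := by
  unfold chainPairing
  refine Finset.sum_congr rfl fun p _ => ?_
  beta_reduce
  rw [weinsteinForm_eq_logDerivForm, pullback_logDerivForm B mdifferentiableAt_fst
    mdifferentiableAt_snd]
  · rfl
  · exact ((mdifferentiable_freeGroup_lift p.1) y).prodMk ((mdifferentiable_freeGroup_lift p.2) y)

theorem pullback_conjAct_chainPairing {m : ℕ} (B : InvariantInnerProduct I G)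
    (c : FreeGroup (Fin m) × FreeGroup (Fin m) →₀ ℤ) (k : G) :
    (chainPairing c (weinsteinForm B)).pullback (conjAct k) =
      chainPairing c (weinsteinForm B) := by
  funext y
  have h : ∀ p : FreeGroup (Fin m) × FreeGroup (Fin m),
      (logDerivForm (ModelWithCorners.pi fun _ : Fin m => I) B
        (fun y => FreeGroup.lift y p.1) (fun y => FreeGroup.lift y p.2)).pullback (conjAct k) y =
      logDerivForm (ModelWithCorners.pi fun _ : Fin m => I) B
        (fun y => FreeGroup.lift y p.1) (fun y => FreeGroup.lift y p.2) y := by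
    intro p
    rw [pullback_logDerivForm B (mdifferentiable_freeGroup_lift _ _)
      (mdifferentiable_freeGroup_lift _ _) (mdifferentiable_conjAct k y)]
    simp only [Function.comp_def, freeGroup_lift_conjAct]
    exact logDerivForm_conj B k (mdifferentiable_freeGroup_lift _ _)
      (mdifferentiable_freeGroup_lift _ _)
  rw [funext (chainPairing_weinsteinForm B c)]
  simp only [Finsupp.sum]
  rw [DForm.pullback_finsetSum_smul]
  simp only [h]

theorem isSmooth_chainPairing [I.Boundaryless] {m : ℕ} (B : InvariantInnerProduct I G)
    (c : FreeGroup (Fin m) × FreeGroup (Fin m) →₀ ℤ) :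
    (chainPairing c (weinsteinForm B)).IsSmooth := by
  intro x
  let J := ModelWithCorners.pi fun _ : Fin m => I
  have hs : ∀ z ∈ (extChartAt J x).target,
      ContMDiffAt 𝓘(ℝ, Fin m → E) J ∞ (extChartAt J x).symm z := fun z hz =>
    (contMDiffOn_extChartAt_symm x).contMDiffAt ((isOpen_extChartAt_target x).mem_nhds hz)
  have e : ∀ z ∈ (extChartAt J x).target, (chainPairing c (weinsteinForm B)).inChart x z =
      ∑ p ∈ c.support, (c p : ℝ) • (logDerivForm 𝓘(ℝ, Fin m → E) B
        ((fun y => FreeGroup.lift y p.1) ∘ (extChartAt J x).symm)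
        ((fun y => FreeGroup.lift y p.2) ∘ (extChartAt J x).symm) z :
          (Fin m → E) [⋀^Fin 2]→L[ℝ] ℝ) := by
    intro z hz
    rw [DForm.inChart_eq_pullback, funext (chainPairing_weinsteinForm B c)]
    simp only [Finsupp.sum]
    rw [DForm.pullback_finsetSum_smul]
    have h : ∀ p : FreeGroup (Fin m) × FreeGroup (Fin m), _ := fun p =>
      pullback_logDerivForm B (mdifferentiable_freeGroup_lift (I := I) p.1 _)
        (mdifferentiable_freeGroup_lift p.2 _) ((hs z hz).mdifferentiableAt (by simp))
    exact Finset.sum_congr rfl fun p _ => by rw [← h]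
  refine ContDiffOn.congr (fun z hz => ContDiffAt.contDiffWithinAt ?_) e
  exact ContDiffAt.sum fun p _ => (contDiffAt_logDerivForm B
    ((contMDiff_freeGroup_lift p.1 _).comp z (hs z hz))
    ((contMDiff_freeGroup_lift p.2 _).comp z (hs z hz))).const_smul _

end SurfaceForm

section Cartan
open Filter Topology

variable {V : Type*} [NormedAddCommGroup V] [NormedSpace ℝ V]

theorem differentiable_curryLeft {n : ℕ} :
    Differentiable ℝ (fun β : V [⋀^Fin (n + 1)]→L[ℝ] ℝ => β.curryLeft) :=
  ContinuousLinearMap.differentiable (E := V [⋀^Fin (n + 1)]→L[ℝ] ℝ)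
    (F := V →L[ℝ] V [⋀^Fin n]→L[ℝ] ℝ)
    (ContinuousAlternatingMap.curryLeftLI (𝕜 := ℝ)).toContinuousLinearMap

/-- Cartan's formula for 2-forms on a normed space, in coordinates. -/
theorem extDeriv_curryLeft_add_curryLeft_extDeriv {β : V → V [⋀^Fin 2]→L[ℝ] ℝ} {X : V → V} {z : V}
    (hβ : DifferentiableAt ℝ β z) (hX : DifferentiableAt ℝ X z) (v w : V) :
    extDeriv (fun z => (β z).curryLeft (X z)) z ![v, w] + extDeriv β z ![X z, v, w] =
      fderiv ℝ β z (X z) ![v, w] + β z ![fderiv ℝ X z v, w] + β z ![v, fderiv ℝ X z w] := by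
  have hc : DifferentiableAt ℝ (fun z => (β z).curryLeft) z :=
    DifferentiableAt.comp (F := V [⋀^Fin 2]→L[ℝ] ℝ) (G := V →L[ℝ] V [⋀^Fin 1]→L[ℝ] ℝ)
      (g := fun γ : V [⋀^Fin 2]→L[ℝ] ℝ => γ.curryLeft) z
      differentiable_curryLeft.differentiableAt hβ
  have hd : DifferentiableAt ℝ (fun z => (β z).curryLeft (X z)) z :=
    DifferentiableAt.clm_apply (H := V [⋀^Fin 1]→L[ℝ] ℝ) hc hX
  have key : ∀ a b : V, fderiv ℝ (fun y => (β y).curryLeft (X y) ![a]) z b =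
      fderiv ℝ β z b ![X z, a] + β z ![fderiv ℝ X z b, a] := by
    intro a b
    have h := fderiv_continuousAlternatingMap_apply_apply (g := ![X, fun _ => a]) hβ
      (by intro i; fin_cases i; exacts [hX, differentiableAt_const a]) b
    have e1 : ∀ y, (fun i => (![X, fun _ => a] : Fin 2 → V → V) i y) = ![X y, a] := by
      intro y; ext i; fin_cases i <;> rfl
    simp only [e1, Fin.sum_univ_two] at h
    have e2 : Function.update ![X z, a] 0 (fderiv ℝ X z b) = ![fderiv ℝ X z b, a] := by
      ext i; fin_cases i <;> rfl
    have e3 : β z (Function.update ![X z, a] 1 (fderiv ℝ (fun _ : V => a) z b)) = 0 := by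
      apply (β z).map_coord_zero 1
      simp
    change _ = _ + (β z (Function.update ![X z, a] 0 (fderiv ℝ X z b)) +
      β z (Function.update ![X z, a] 1 (fderiv ℝ (fun _ : V => a) z b))) at h
    rw [e3, e2, add_zero] at h
    exact h
  have swap : ∀ (γ : V [⋀^Fin 2]→L[ℝ] ℝ) (a b : V), γ ![b, a] = - γ ![a, b] := by
    intro γ a b
    refine Eq.trans ?_ (γ.toAlternatingMap.map_swap ![a, b] (i := 0) (j := 1) (by decide))
    change _ = γ _
    congr 1
    ext i; fin_cases i <;> rfl
  rw [extDeriv_apply hd, extDeriv_apply hβ, Fin.sum_univ_two, Fin.sum_univ_three]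
  have r1 : (0 : Fin 2).removeNth ![v, w] = ![w] := by ext i; fin_cases i; rfl
  have r2 : (1 : Fin 2).removeNth ![v, w] = ![v] := by ext i; fin_cases i; rfl
  have r3 : (0 : Fin 3).removeNth ![X z, v, w] = ![v, w] := by ext i; fin_cases i <;> rfl
  have r4 : (1 : Fin 3).removeNth ![X z, v, w] = ![X z, w] := by ext i; fin_cases i <;> rfl
  have r5 : (2 : Fin 3).removeNth ![X z, v, w] = ![X z, v] := by ext i; fin_cases i <;> rfl
  simp only [r1, r2, r3, r4, r5, key, fderiv_continuousAlternatingMap_apply_const_apply hβ]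
  simp only [Fin.val_zero, pow_zero, one_smul, Fin.val_one, pow_one, Fin.val_two, neg_smul,
    Matrix.cons_val_zero, Matrix.cons_val_one, Matrix.cons_val, even_two, Even.neg_pow, one_pow]
  rw [swap (β z) v (fderiv ℝ X z w)]
  ring

/-- If a 2-form is invariant at `z₀` under a family `F t` of maps with `F 0 = id`, then its
derivative along the velocity field of the family vanishes at `z₀`. -/
theorem lieDeriv_eq_zero_of_invariant {β : V → V [⋀^Fin 2]→L[ℝ] ℝ} {F : ℝ × V → V} {X : V → V}
    {z₀ : V} (hβ : DifferentiableAt ℝ β z₀) (hF : ContDiffAt ℝ 2 F (0, z₀))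
    (hF0 : ∀ᶠ z in 𝓝 z₀, F (0, z) = z)
    (hX : ∀ᶠ z in 𝓝 z₀, X z = fderiv ℝ (fun t => F (t, z)) 0 1)
    (hinv : ∀ᶠ t in 𝓝 (0 : ℝ),
      (β (F (t, z₀))).compContinuousLinearMap (fderiv ℝ (fun z => F (t, z)) z₀) = β z₀) :
    DifferentiableAt ℝ X z₀ ∧ ∀ v w : V,
      fderiv ℝ β z₀ (X z₀) ![v, w] + β z₀ ![fderiv ℝ X z₀ v, w] + β z₀ ![v, fderiv ℝ X z₀ w]
        = 0 := by
  have hdF : ∀ᶠ p in 𝓝 ((0 : ℝ), z₀), DifferentiableAt ℝ F p := by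
    filter_upwards [hF.eventually (by simp)] with p hp using hp.differentiableAt (by simp)
  have hD : DifferentiableAt ℝ (fderiv ℝ F) (0, z₀) :=
    (hF.fderiv_right (m := 1) (by norm_num)).differentiableAt (by simp)
  have hiz : HasFDerivAt (fun z : V => ((0 : ℝ), z)) (ContinuousLinearMap.inr ℝ ℝ V) z₀ :=
    hasFDerivAt_prodMk_right 0 z₀
  have hit : HasFDerivAt (fun t : ℝ => (t, z₀)) (ContinuousLinearMap.inl ℝ ℝ V) 0 :=
    hasFDerivAt_prodMk_left 0 z₀
  have hX' : X =ᶠ[𝓝 z₀] fun z => fderiv ℝ F (0, z) (1, 0) := by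
    filter_upwards [hX, hiz.continuousAt.eventually hdF] with z hz hd
    have h : HasFDerivAt (fun t => F (t, z))
        ((fderiv ℝ F (0, z)).comp (ContinuousLinearMap.inl ℝ ℝ V)) (0 : ℝ) :=
      hd.hasFDerivAt.comp (0 : ℝ) (hasFDerivAt_prodMk_left (0 : ℝ) z)
    rw [hz, h.fderiv]
    simp
  have hXd : HasFDerivAt X
      ((ContinuousLinearMap.apply ℝ V ((1 : ℝ), (0 : V))).comp
        ((fderiv ℝ (fderiv ℝ F) (0, z₀)).comp (ContinuousLinearMap.inr ℝ ℝ V))) z₀ :=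
    ((ContinuousLinearMap.hasFDerivAt _).comp z₀
      (hD.hasFDerivAt.comp z₀ hiz)).congr_of_eventuallyEq hX'
  have hsymm : IsSymmSndFDerivAt ℝ F (0, z₀) := hF.isSymmSndFDerivAt (by simp)
  refine ⟨hXd.differentiableAt, fun v w => ?_⟩
  have hF00 : F (0, z₀) = z₀ := hF0.self_of_nhds
  have hz : ∀ u : V, fderiv ℝ (fun z => F (0, z)) z₀ u = u := by
    intro u
    have : (fun z => F (0, z)) =ᶠ[𝓝 z₀] id := hF0
    rw [this.fderiv_eq, fderiv_id]; rfl
  have hpart : ∀ᶠ t in 𝓝 (0 : ℝ), ∀ u : V,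
      fderiv ℝ (fun z => F (t, z)) z₀ u = fderiv ℝ F (t, z₀) (0, u) := by
    filter_upwards [hit.continuousAt.eventually hdF] with t hd u
    have h : HasFDerivAt (fun z => F (t, z))
        ((fderiv ℝ F (t, z₀)).comp (ContinuousLinearMap.inr ℝ ℝ V)) z₀ :=
      hd.hasFDerivAt.comp z₀ (hasFDerivAt_prodMk_right t z₀)
    rw [h.fderiv]
    simp
  have hcol : ∀ u : V, HasFDerivAt (fun t : ℝ => fderiv ℝ F (t, z₀) (0, u))
      ((ContinuousLinearMap.apply ℝ V ((0 : ℝ), u)).comp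
        ((fderiv ℝ (fderiv ℝ F) (0, z₀)).comp (ContinuousLinearMap.inl ℝ ℝ V))) 0 := fun u =>
    (ContinuousLinearMap.apply ℝ V ((0 : ℝ), u)).hasFDerivAt.comp (0 : ℝ) (hD.hasFDerivAt.comp (0 : ℝ) hit)
  have hcol1 : ∀ u : V, fderiv ℝ (fun t : ℝ => fderiv ℝ F (t, z₀) (0, u)) 0 1 =
      fderiv ℝ X z₀ u := by
    intro u
    rw [(hcol u).fderiv, hXd.fderiv]
    exact hsymm.eq _ _
  have hFt : HasFDerivAt (fun t : ℝ => F (t, z₀))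
      ((fderiv ℝ F (0, z₀)).comp (ContinuousLinearMap.inl ℝ ℝ V)) 0 :=
    hdF.self_of_nhds.hasFDerivAt.comp (0 : ℝ) hit
  have hβF : HasFDerivAt (fun t : ℝ => β (F (t, z₀)))
      ((fderiv ℝ β z₀).comp ((fderiv ℝ F (0, z₀)).comp (ContinuousLinearMap.inl ℝ ℝ V))) 0 := by
    refine HasFDerivAt.comp (g := β) (0 : ℝ) ?_ hFt
    rw [hF00]; exact hβ.hasFDerivAt
  have hconst : (fun t : ℝ => β (F (t, z₀))
      fun i => (![fun t => fderiv ℝ F (t, z₀) (0, v), fun t => fderiv ℝ F (t, z₀) (0, w)] :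
        Fin 2 → ℝ → V) i t) =ᶠ[𝓝 0] fun _ => β z₀ ![v, w] := by
    filter_upwards [hinv, hpart] with t ht hp
    rw [← ht]
    change _ = β (F (t, z₀)) _
    congr 1
    ext i; fin_cases i
    · exact (hp v).symm
    · exact (hp w).symm
  have hder := hconst.fderiv_eq (𝕜 := ℝ)
  have h := fderiv_continuousAlternatingMap_apply_apply
    (g := ![fun t => fderiv ℝ F (t, z₀) (0, v), fun t => fderiv ℝ F (t, z₀) (0, w)])
    hβF.differentiableAt
    (by intro i; fin_cases i; exacts [(hcol v).differentiableAt, (hcol w).differentiableAt])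
    (1 : ℝ)
  rw [hder, hβF.fderiv, Fin.sum_univ_two] at h
  have e0 : (fun i => (![fun t => fderiv ℝ F (t, z₀) (0, v), fun t => fderiv ℝ F (t, z₀) (0, w)] :
        Fin 2 → ℝ → V) i 0) = ![v, w] := by
    ext i; fin_cases i
    · exact (hpart.self_of_nhds v).symm.trans (hz v)
    · exact (hpart.self_of_nhds w).symm.trans (hz w)
  rw [e0, hF00] at h
  have u0 : ∀ a : V, Function.update ![v, w] 0 a = ![a, w] := by
    intro a; ext i; fin_cases i <;> rfl
  have u1 : ∀ a : V, Function.update ![v, w] 1 a = ![v, a] := by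
    intro a; ext i; fin_cases i <;> rfl
  simp only [Matrix.cons_val_zero, Matrix.cons_val_one, hcol1, u0, u1] at h
  rw [hX'.eq_of_nhds]
  simpa [add_assoc] using h.symm

end Cartan

section LieDerivative
open Filter Topology

variable {E : Type*} [NormedAddCommGroup E] [NormedSpace ℝ E]
  {H : Type*} [TopologicalSpace H] {I : ModelWithCorners ℝ E H} [I.Boundaryless]
  {M : Type*} [TopologicalSpace M] [ChartedSpace H M] [IsManifold I ∞ M]

variable (I) in
/-- A family of maps `Φ t : M → M` in the chart around `x`. -/
def familyInChart (Φ : ℝ × M → M) (x : M) (p : ℝ × E) : E :=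
  extChartAt I x (Φ (p.1, (extChartAt I x).symm p.2))

theorem contDiffAt_familyInChart {Φ : ℝ × M → M} {x : M} {z : E}
    (hz : z ∈ (extChartAt I x).target)
    (hΦ : ContMDiffAt (𝓘(ℝ, ℝ).prod I) I ∞ Φ (0, (extChartAt I x).symm z))
    (hΦ0 : ∀ y, Φ (0, y) = y) :
    ContDiffAt ℝ ∞ (familyInChart I Φ x) (0, z) := by
  have hs : ContMDiffAt 𝓘(ℝ, ℝ × E) I ∞ (fun p : ℝ × E => (extChartAt I x).symm p.2) (0, z) :=
    ContMDiffAt.comp (I' := 𝓘(ℝ, E)) (g := (extChartAt I x).symm) ((0 : ℝ), z)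
      ((contMDiffOn_extChartAt_symm x).contMDiffAt ((isOpen_extChartAt_target x).mem_nhds hz))
      contDiff_snd.contMDiff.contMDiffAt
  have h₁ : ContMDiffAt 𝓘(ℝ, ℝ × E) (𝓘(ℝ, ℝ).prod I) ∞
      (fun p : ℝ × E => (p.1, (extChartAt I x).symm p.2)) (0, z) :=
    (contDiff_fst.contMDiff.contMDiffAt).prodMk hs
  have h₂ : ContMDiffAt 𝓘(ℝ, ℝ × E) I ∞
      (fun p : ℝ × E => Φ (p.1, (extChartAt I x).symm p.2)) (0, z) := hΦ.comp ((0 : ℝ), z) h₁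
  refine ContMDiffAt.contDiffAt (ContMDiffAt.comp (I' := I) (g := extChartAt I x)
    ((0 : ℝ), z) ?_ h₂)
  refine contMDiffAt_extChartAt' ?_
  rw [hΦ0, ← extChartAt_source I]
  exact (extChartAt I x).map_target hz

/-- The velocity field at time `0` of a family of maps, in a chart. -/
theorem mfderiv_extChartAt_symm_velocity {Φ : ℝ × M → M} {x : M} {z : E}
    (hz : z ∈ (extChartAt I x).target)
    (hΦ : ContMDiffAt (𝓘(ℝ, ℝ).prod I) I ∞ Φ (0, (extChartAt I x).symm z))
    (hΦ0 : ∀ y, Φ (0, y) = y) :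
    (mfderiv 𝓘(ℝ, E) I (extChartAt I x).symm z
      (fderiv ℝ (fun t => familyInChart I Φ x (t, z)) 0 1) : E) =
      mfderiv 𝓘(ℝ, ℝ) I (fun t : ℝ => Φ (t, (extChartAt I x).symm z)) 0 (1 : ℝ) := by
  have hF0 : familyInChart I Φ x (0, z) = z := by
    simp only [familyInChart, hΦ0, (extChartAt I x).right_inv hz]
  have hF : DifferentiableAt ℝ (fun t => familyInChart I Φ x (t, z)) 0 :=
    DifferentiableAt.comp (g := familyInChart I Φ x) (f := fun t : ℝ => (t, z)) (0 : ℝ)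
      ((contDiffAt_familyInChart hz hΦ hΦ0).differentiableAt (by simp))
      (differentiableAt_id.prodMk (differentiableAt_const z))
  have hs := mdifferentiableAt_extChartAt_symm hz
  rw [← hF0] at hs
  have hc := mfderiv_comp_apply (0 : ℝ) (f := fun t => familyInChart I Φ x (t, z)) hs
    hF.mdifferentiableAt (1 : ℝ)
  have hcont : ContinuousAt (fun t : ℝ => Φ (t, (extChartAt I x).symm z)) 0 :=
    hΦ.continuousAt.comp (f := fun t : ℝ => (t, (extChartAt I x).symm z))
      (by fun_prop)
  have hev : (extChartAt I x).symm ∘ (fun t => familyInChart I Φ x (t, z)) =ᶠ[𝓝 0]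
      fun t : ℝ => Φ (t, (extChartAt I x).symm z) := by
    have : (extChartAt I x).source ∈ 𝓝 (Φ (0, (extChartAt I x).symm z)) := by
      rw [hΦ0]
      exact (isOpen_extChartAt_source x).mem_nhds ((extChartAt I x).map_target hz)
    filter_upwards [hcont.preimage_mem_nhds this] with t ht
    exact (extChartAt I x).left_inv ht
  have h₁ : (mfderiv 𝓘(ℝ, ℝ) I
      ((extChartAt I x).symm ∘ fun t => familyInChart I Φ x (t, z)) 0 : ℝ →L[ℝ] E) =
      mfderiv 𝓘(ℝ, ℝ) I (fun t : ℝ => Φ (t, (extChartAt I x).symm z)) 0 := hev.mfderiv_eq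
  have h₂ : ∀ w w' : E, w = w' → (mfderiv 𝓘(ℝ, E) I (extChartAt I x).symm w : E →L[ℝ] E) =
      mfderiv 𝓘(ℝ, E) I (extChartAt I x).symm w' := by
    rintro w _ rfl; rfl
  refine Eq.trans ?_ (DFunLike.congr_fun h₁ (1 : ℝ))
  refine Eq.trans ?_ hc.symm
  rw [mfderiv_eq_fderiv]
  exact DFunLike.congr_fun (h₂ z (familyInChart I Φ x (0, z)) hF0.symm) _

theorem DForm.inChart_interior {β : DForm I M 2} {Φ : ℝ × M → M} {x : M} {z : E}
    (hz : z ∈ (extChartAt I x).target)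
    (hΦ : ContMDiffAt (𝓘(ℝ, ℝ).prod I) I ∞ Φ (0, (extChartAt I x).symm z))
    (hΦ0 : ∀ y, Φ (0, y) = y) {X : ∀ y : M, TangentSpace I y}
    (hX : ∀ y, X y = mfderiv 𝓘(ℝ, ℝ) I (fun t : ℝ => Φ (t, y)) 0 (1 : ℝ)) :
    DForm.inChart (k := 1) (β.interior X) x z =
      (β.inChart x z).curryLeft (fderiv ℝ (fun t => familyInChart I Φ x (t, z)) 0 1) := by
  rw [DForm.inChart_eq_pullback, DForm.inChart_eq_pullback]
  ext v
  change (β _ : E [⋀^Fin 2]→L[ℝ] ℝ) _ = (β _ : E [⋀^Fin 2]→L[ℝ] ℝ) _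
  congr 1
  funext i
  refine Fin.cases ?_ (fun j => ?_) i
  · exact (hX _).trans (mfderiv_extChartAt_symm_velocity hz hΦ hΦ0).symm
  · rfl

/-- A smooth 2-form invariant under a family of maps through the identity has zero Lie derivative
along the velocity field of the family. -/
theorem DForm.lieDeriv_eq_zero_of_invariant {β : DForm I M 2} (hβ : β.IsSmooth) {Φ : ℝ × M → M}
    (hΦ : ∀ᶠ t in 𝓝 (0 : ℝ), ∀ y, ContMDiffAt (𝓘(ℝ, ℝ).prod I) I ∞ Φ (t, y))
    (hΦ0 : ∀ y, Φ (0, y) = y) (hinv : ∀ t, β.pullback (fun y => Φ (t, y)) = β)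
    {X : ∀ y : M, TangentSpace I y}
    (hX : ∀ y, X y = mfderiv 𝓘(ℝ, ℝ) I (fun t : ℝ => Φ (t, y)) 0 (1 : ℝ)) :
    β.lieDeriv X = 0 := by
  funext x
  have hz₀ := mem_extChartAt_target (I := I) x
  have hx : (extChartAt I x).symm (extChartAt I x x) = x := extChartAt_to_inv x
  have htarget : (extChartAt I x).target ∈ 𝓝 (extChartAt I x x) :=
    (isOpen_extChartAt_target x).mem_nhds hz₀
  have hβd : DifferentiableAt ℝ (β.inChart x) (extChartAt I x x) :=
    ((hβ x).contDiffAt htarget).differentiableAt (by simp)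
  have hΦz := hΦ.self_of_nhds
  obtain ⟨hXd, key⟩ := SurfaceForm.lieDeriv_eq_zero_of_invariant
    (X := fun z => fderiv ℝ (fun t => familyInChart I Φ x (t, z)) 0 1)
    hβd ((contDiffAt_familyInChart hz₀ (hΦz _) hΦ0).of_le (by norm_cast))
    (by filter_upwards [htarget] with z hz
        simp only [familyInChart, hΦ0, (extChartAt I x).right_inv hz])
    (Eventually.of_forall fun z => rfl) (by
      have hcont : ContinuousAt (fun t : ℝ => Φ (t, x)) 0 :=
        (hΦz x).continuousAt.comp (f := fun t : ℝ => (t, x)) (by fun_prop)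
      have hsrc : (extChartAt I x).source ∈ 𝓝 (Φ (0, x)) := by
        rw [hΦ0]; exact extChartAt_source_mem_nhds x
      filter_upwards [hΦ, hcont.preimage_mem_nhds hsrc] with t ht hts
      have hmd : MDifferentiableAt I I (fun y => Φ (t, y)) x :=
        ((ht x).comp (f := fun y : M => (t, y)) x
          (contMDiffAt_const.prodMk contMDiffAt_id)).mdifferentiableAt (by simp)
      have hsz := mdifferentiableAt_extChartAt_symm hz₀
      have hFz : familyInChart I Φ x (t, extChartAt I x x) = extChartAt I x (Φ (t, x)) := by
        simp only [familyInChart, hx]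
      have hmd' : MDifferentiableAt I I (fun y => Φ (t, y))
          ((extChartAt I x).symm (extChartAt I x x)) := by rwa [hx]
      have hcomp := hmd'.comp (extChartAt I x x) hsz
      have hFd : MDifferentiableAt 𝓘(ℝ, E) 𝓘(ℝ, E) (fun z => familyInChart I Φ x (t, z))
          (extChartAt I x x) := by
        refine MDifferentiableAt.comp (I' := I) (g := extChartAt I x) (extChartAt I x x) ?_ hcomp
        refine mdifferentiableAt_extChartAt ?_
        simp only [hx]
        rwa [← extChartAt_source I]
      have hst : MDifferentiableAt 𝓘(ℝ, E) I (extChartAt I x).symm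
          (familyInChart I Φ x (t, extChartAt I x x)) := by
        rw [hFz]
        exact mdifferentiableAt_extChartAt_symm ((extChartAt I x).map_source hts)
      have hev : (extChartAt I x).symm ∘ (fun z => familyInChart I Φ x (t, z))
          =ᶠ[𝓝 (extChartAt I x x)] (fun y => Φ (t, y)) ∘ (extChartAt I x).symm := by
        have : (extChartAt I x).source ∈
            𝓝 (((fun y => Φ (t, y)) ∘ (extChartAt I x).symm) (extChartAt I x x)) := by
          simp only [Function.comp, hx]
          exact (isOpen_extChartAt_source x).mem_nhds hts
        filter_upwards [hcomp.continuousAt.preimage_mem_nhds this] with z hz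
        exact (extChartAt I x).left_inv hz
      have e₁ := DForm.pullback_pullback (I := 𝓘(ℝ, E)) β
        (f := fun z => familyInChart I Φ x (t, z)) hst hFd
      have e₂ := DForm.pullback_congr (I := 𝓘(ℝ, E)) β hev
      have e₃ := DForm.pullback_pullback (I := 𝓘(ℝ, E)) β hmd' hsz
      rw [hinv] at e₃
      have e₄ := e₁.trans (e₂.trans e₃.symm)
      rw [DForm.inChart_eq_pullback, DForm.inChart_eq_pullback, ← e₄, ← mfderiv_eq_fderiv]
      rfl)
  have hι : DForm.inChart (k := 1) (β.interior X) x =ᶠ[𝓝 (extChartAt I x x)] fun z =>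
      (β.inChart x z).curryLeft (fderiv ℝ (fun t => familyInChart I Φ x (t, z)) 0 1) := by
    filter_upwards [htarget] with z hz using DForm.inChart_interior hz (hΦz _) hΦ0 hX
  have hXx : fderiv ℝ (fun t => familyInChart I Φ x (t, extChartAt I x x)) 0 1 = X x := by
    have h := mfderiv_extChartAt_symm_velocity hz₀ (hΦz _) hΦ0
    have hid := mfderivWithin_range_extChartAt_symm (I := I) (x := x)
    rw [I.range_eq_univ, mfderivWithin_univ] at hid
    have h' : ∀ y, y = x → (mfderiv 𝓘(ℝ, ℝ) I (fun t : ℝ => Φ (t, y)) 0 : ℝ →L[ℝ] E) =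
        mfderiv 𝓘(ℝ, ℝ) I (fun t : ℝ => Φ (t, x)) 0 := by
      rintro _ rfl; rfl
    exact ((DFunLike.congr_fun (F := E →L[ℝ] E) hid _).symm.trans h).trans
      ((DFunLike.congr_fun (h' ((extChartAt I x).symm (extChartAt I x x)) hx) (1 : ℝ)).trans (hX x).symm)
  have hd : ∀ {k : ℕ} (γ : DForm I M k),
      γ.d x = (extDeriv (γ.inChart x) (extChartAt I x x) : E [⋀^Fin (k + 1)]→L[ℝ] ℝ) := by
    intro k γ
    unfold DForm.d
    rw [I.range_eq_univ, extDerivWithin_univ, mfderiv_extChartAt_self]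
    rfl
  ext v
  have cartan := extDeriv_curryLeft_add_curryLeft_extDeriv hβd hXd (v 0) (v 1)
  rw [← hι.extDeriv.eq_of_nhds] at cartan
  refine Eq.trans ?_ (cartan.trans (key (v 0) (v 1)))
  have hv : v = ![v 0, v 1] := by ext i; fin_cases i <;> rfl
  have h₁ : (DForm.d (k := 1) (β.interior X)) x v =
      extDeriv (DForm.inChart (k := 1) (β.interior X) x) (extChartAt I x x) ![v 0, v 1] := by
    rw [hd]; exact congrArg _ hv
  have h₂ : (β.d.interior X) x v = extDeriv (β.inChart x) (extChartAt I x x)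
      ![fderiv ℝ (fun t => familyInChart I Φ x (t, extChartAt I x x)) 0 1, v 0, v 1] := by
    rw [hXx]
    change (β.d x : E [⋀^Fin 3]→L[ℝ] ℝ) _ = _
    rw [hd]
    refine congrArg _ ?_
    funext i
    fin_cases i <;> rfl
  exact congrArg₂ (· + ·) h₁ h₂

end LieDerivative

section Conjugation
open Filter Topology

variable {E : Type*} [NormedAddCommGroup E] [NormedSpace ℝ E]
  {H : Type*} [TopologicalSpace H] {I : ModelWithCorners ℝ E H}
  {G : Type*} [TopologicalSpace G] [ChartedSpace H G] [Group G]

variable (I G) in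
/-- A curve in `G` through `1` with velocity `η`. -/
def curveThroughOne (η : E) (t : ℝ) : G :=
  (extChartAt I (1 : G)).symm (extChartAt I (1 : G) 1 + t • η)

theorem curveThroughOne_zero (η : E) : curveThroughOne I G η 0 = 1 := by
  simp [curveThroughOne]

variable [I.Boundaryless] [LieGroup I ∞ G]

theorem contMDiffAt_curveThroughOne (η : E) :
    ∀ᶠ t in 𝓝 (0 : ℝ), ContMDiffAt 𝓘(ℝ, ℝ) I ∞ (curveThroughOne I G η) t := by
  have hl : ContDiff ℝ ∞ (fun t : ℝ => extChartAt I (1 : G) 1 + t • η) :=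
    contDiff_const.add (contDiff_id.smul contDiff_const)
  have ht : (extChartAt I (1 : G)).target ∈
      𝓝 (extChartAt I (1 : G) 1 + (0 : ℝ) • η) := by
    rw [zero_smul, add_zero]
    exact (isOpen_extChartAt_target _).mem_nhds (mem_extChartAt_target _)
  filter_upwards [hl.continuous.continuousAt.preimage_mem_nhds ht] with t h
  exact ContMDiffAt.comp (I' := 𝓘(ℝ, E)) t ((contMDiffOn_extChartAt_symm (1 : G)).contMDiffAt
    ((isOpen_extChartAt_target _).mem_nhds h)) hl.contMDiff.contMDiffAt

theorem mfderiv_curveThroughOne (η : E) :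
    (mfderiv 𝓘(ℝ, ℝ) I (curveThroughOne I G η) 0 (1 : ℝ) : E) = η := by
  let l : ℝ → E := fun t => extChartAt I (1 : G) 1 + t • η
  have hl : HasFDerivAt l (ContinuousLinearMap.toSpanSingleton ℝ η) 0 :=
    (ContinuousLinearMap.toSpanSingleton ℝ η).hasFDerivAt.const_add _
  have hl0 : l 0 = extChartAt I (1 : G) 1 := by simp [l]
  have hs : MDifferentiableAt 𝓘(ℝ, E) I (extChartAt I (1 : G)).symm (l 0) := by
    rw [hl0]; exact mdifferentiableAt_extChartAt_symm (mem_extChartAt_target _)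
  have h := mfderiv_comp_apply (0 : ℝ) hs hl.differentiableAt.mdifferentiableAt (1 : ℝ)
  rw [mfderiv_eq_fderiv, hl.fderiv] at h
  have hid := mfderivWithin_range_extChartAt_symm (I := I) (x := (1 : G))
  rw [I.range_eq_univ, mfderivWithin_univ] at hid
  have h' : ∀ w, w = extChartAt I (1 : G) 1 →
      (mfderiv 𝓘(ℝ, E) I (extChartAt I (1 : G)).symm w : E →L[ℝ] E) =
        ContinuousLinearMap.id ℝ E := by
    rintro _ rfl; exact hid
  refine h.trans ((DFunLike.congr_fun (h' _ hl0) _).trans ?_)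
  exact one_smul ℝ η

theorem lieDeriv_generatedField_eq_zero {m : ℕ}
    {β : DForm (ModelWithCorners.pi fun _ : Fin m => I) (Fin m → G) 2} (hβ : β.IsSmooth)
    (hinv : ∀ k : G, β.pullback (conjAct k) = β) (η : GroupLieAlgebra I G) :
    β.lieDeriv (generatedField η) = 0 := by
  have hk := contMDiffAt_curveThroughOne (I := I) (G := G) η
  refine DForm.lieDeriv_eq_zero_of_invariant hβ
    (Φ := fun p => conjAct (curveThroughOne I G η p.1) p.2) ?_ ?_
    (fun t => hinv (curveThroughOne I G η t)) ?_
  · filter_upwards [hk] with t ht y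
    exact (contMDiff_conjAct (curveThroughOne I G η t, y)).comp (t, y)
      ((ContMDiffAt.comp (g := curveThroughOne I G η) (t, y) ht contMDiffAt_fst).prodMk
        contMDiffAt_snd)
  · intro y
    funext i
    simp only [curveThroughOne_zero (I := I) η, conjAct]
    simp
  · intro y
    have hc : MDifferentiable I (ModelWithCorners.pi fun _ : Fin m => I)
        (fun k : G => conjAct k y) :=
      (contMDiff_conjAct.comp (contMDiff_id.prodMk contMDiff_const)).mdifferentiable (by simp)
    have h := mfderiv_comp_apply (0 : ℝ) (hc (curveThroughOne I G η 0))
      (hk.self_of_nhds.mdifferentiableAt (by simp)) (1 : ℝ)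
    have h' : ∀ k : G, k = 1 → (mfderiv I (ModelWithCorners.pi fun _ : Fin m => I)
        (fun k : G => conjAct k y) k : E →L[ℝ] Fin m → E) =
        mfderiv I (ModelWithCorners.pi fun _ : Fin m => I) (fun k : G => conjAct k y) 1 := by
      rintro _ rfl; rfl
    refine Eq.trans ?_ h.symm
    refine Eq.trans ?_ (DFunLike.congr_fun (h' (curveThroughOne I G η 0) (curveThroughOne_zero (I := I) η)) _).symm
    exact congrArg (mfderiv I (ModelWithCorners.pi fun _ : Fin m => I)
        (fun k : G => conjAct k y) 1 : E →L[ℝ] Fin m → E) (mfderiv_curveThroughOne (I := I) (G := G) (E := E) η).symm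

end Conjugation

end SurfaceForm

end

theorem propositionp4 {E : Type*} [NormedAddCommGroup E] [NormedSpace ℝ E] [FiniteDimensional ℝ E]
    {H : Type*} [TopologicalSpace H] {I : ModelWithCorners ℝ E H} [I.Boundaryless]
    {G : Type*} [TopologicalSpace G] [ChartedSpace H G] [Group G] [LieGroup I ∞ G]
    [CompactSpace G] [ConnectedSpace G]
    (B : SurfaceForm.InvariantInnerProduct I G) (g : ℕ) :
    (SurfaceForm.surfaceForm B g).IsSmooth ∧
    (∀ k : G, (SurfaceForm.surfaceForm B g).pullback (SurfaceForm.conjAct k) =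
      SurfaceForm.surfaceForm B g) ∧
    (∀ η : GroupLieAlgebra I G,
      (SurfaceForm.surfaceForm B g).lieDeriv (SurfaceForm.generatedField η) = 0) := by
  have hs := SurfaceForm.isSmooth_chainPairing B (SurfaceForm.surfaceChain g)
  have hi := SurfaceForm.pullback_conjAct_chainPairing B (SurfaceForm.surfaceChain g)
  exact ⟨hs, hi, SurfaceForm.lieDeriv_generatedField_eq_zero hs hi⟩
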